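/- Let $\aleph$ be an infinite cardinal; for a cardinal $\kappa$ let $o(\kappa)$ be the least ordinal of cardinality $\kappa$. **Machine.** A serial $\langle\kappa,\kappa,\kappa\rangle$-hypercomputer has disjoint sets of registers $I$ (input, read-only), $W_\beta$ for $\beta<o(\kappa)$ (working) and $O$ (output, write-only). Each set consists of registers numbered by the ordinals $<o(\kappa)$, each register contains $0$ or $1$, and each set has a current register (initially number $0$). All registers except the input registers initially contain $0$. A program is a transfinite sequence, of length at most $o(\kappa)$, of instructions $\langle$current state, readable register set, symbol, action, next state$\rangle$, whose states are ordinals $<o(\kappa)$, together with a halting state $\le o(\kappa)$; it is deterministic, and the next state of an instruction is the halting state or lies between the same two consecutive limit ordinals as the current state. An instruction applies if the machine is in its current state and the current register of its register set contains its symbol. The actions are: do nothing; write $0$ or $1$ to the current register of $W_\beta$ or $O$; move one register left or right (where possible) in, or return to register $0$ of, one register set. The program starts in state $0$; at limit steps the state, the numbers of the current registers and the contents of all registers are the $\limsup$ of their earlier values. The program halts when it is in the halting state or no instruction applies. It *answers* a proposition if it halts after fewer than $o(\kappa)$ steps with output $1,0,0,\dots$ if the proposition is true and $0,0,0,\dots$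 if it is false. **Sets.** For an infinite cardinal $\kappa$, a binary sequence $b$ of ordinal length $o(\kappa)\cdot o(\kappa)$ *represents* a set $x$ if there are sets $f_i$ $(i<o(\kappa))$ with $f_0=x$ and $f_i=\{f_j : j<o(\kappa),\ b_{o(\kappa)\cdot i+j}=1\}$ for all $i<o(\kappa)$. A set *requires $\le\kappa$ bits of information to define* if some such sequence represents it. Let $D$ be the collection of all sets that require $\le\aleph$ bits. **Theorem 14.** a) There is a program of a serial $\langle 2^\aleph,2^\aleph,2^\aleph\rangle$-hypercomputer which, given any first-order formula in $\in$ and $=$ (as its Gödel number, in unary) and binary sequences that represent any values in $D$ of its variables, answers whether the formula is true of these values in $V$ with all quantifiers ranging over $D$. b) For all specific sets $A_0,A_1,A_2,\dots$, each of which requires $\le 2^\aleph$ bits, there is a program of a serial $\langle 2^\aleph,2^\aleph,2^\aleph\rangle$-hypercomputer that does the same for all first-order formulas that may also contain atomic formulas $x\in A_k$. c) There is a program of a serial $\langle 2^{2^\aleph},2^{2^\aleph},2^{2^\aleph}\rangle$-hypercomputer which, given any second-order formula (with first-order variables $x_i$, second-order variables $X_j$, and atomic formulas $x_i=x_j$,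 $x_i\in x_j$, $x_i\in X_j$), binary sequences that represent any values in $D$ of its first-order variables, and binary sequences that represent any values of its second-order variables among the sets that require $\le 2^\aleph$ bits, answers whether the formula is true of these values, with first-order quantifiers ranging over $D$ and second-order quantifiers ranging over all sets of elements of $D$. The formula and the sequences are presented interleaved: input register number $\omega\cdot i+n$ contains bit $i$ of the $n$-th sequence. Sequence $0$ has its only $1$ at the Gödel number of the formula. In a) and b) sequence $n+1$ represents the value of $x_n$; in c) sequence $2n+1$ represents the value of $x_n$ and sequence $2n+2$ that of $X_n$. Sequences are continued by zeros. -/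

import Mathlib

open Ordinal Cardinal

universe u

noncomputable section

namespace Hypercomputer

/-! ### The machine -/

/-- The disjoint sets of registers of a hypercomputer: the (read-only) input registers `I`, the
working registers `W β`, one set for each ordinal `β`, and the (write-only) output registers `O`.
The individual registers of each set are numbered by ordinals. -/
inductive RegSet : Type (u + 1)
  | I : RegSet
  | W (β : Ordinal.{u}) : RegSet
  | O : RegSet

/-- The sets of registers that an instruction can read: all of them, except the output registers. -/
inductive ReadSet : Type (u + 1)
  | I : ReadSet
  | W (β : Ordinal.{u}) : ReadSet

/-- A readable set of registers, as a set of registers. -/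
def ReadSet.toRegSet : ReadSet.{u} → RegSet.{u}
  | ReadSet.I => RegSet.I
  | ReadSet.W β => RegSet.W β

/-- The actions: do nothing, write a symbol to the current register of `W β` or of `O`, move left,
move right or return to the register number `0` in any of the sets of registers. -/
inductive Action : Type (u + 1)
  | nothing : Action
  | writeW (β : Ordinal.{u}) (s : Bool) : Action
  | writeO (s : Bool) : Action
  | left (R : RegSet.{u}) : Action
  | right (R : RegSet.{u}) : Action
  | reset (R : RegSet.{u}) : Action

/-- A program instruction, that is a 5-tuple
⟨current state, register set, symbol, action, next state⟩. -/
structure Instruction : Type (u + 1) where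
  current : Ordinal.{u}
  source : ReadSet.{u}
  symbol : Bool
  action : Action.{u}
  next : Ordinal.{u}

/-- A program: a transfinite sequence of instructions, together with its halting state. -/
structure Program : Type (u + 1) where
  length : Ordinal.{u}
  instr : Set.Iio length → Instruction.{u}
  halt : Ordinal.{u}

/-- The size ⟨registers, program, time⟩ of a hypercomputer, where time ≤ program ≤ registers. -/
structure Size : Type (u + 1) where
  registers : Cardinal.{u}
  program : Cardinal.{u}
  time : Cardinal.{u}
  time_le : time ≤ program
  program_le : program ≤ registers

/-- The size ⟨κ, κ, κ⟩. -/
def Size.uniform (κ : Cardinal.{u}) : Size.{u} := ⟨κ, κ, κ, le_rfl, le_rfl⟩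

/-- The last limit ordinal `≤ α` (where `0` counts as a limit). -/
def prevLim (α : Ordinal.{u}) : Ordinal.{u} := ω * (α / ω)

/-- The first limit ordinal `> α`. -/
def nextLim (α : Ordinal.{u}) : Ordinal.{u} := prevLim α + ω

/-- The set of registers is one of those of a machine whose working registers are `W β`,
`β < o(κ)`. -/
def RegSet.Fits (κ : Cardinal.{u}) : RegSet.{u} → Prop
  | RegSet.W β => β < κ.ord
  | _ => True

/-- The action only addresses the registers of a machine with working registers `W β`,
`β < o(κ)`. -/
def Action.Fits (κ : Cardinal.{u}) : Action.{u} → Prop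
  | Action.nothing => True
  | Action.writeW β _ => β < κ.ord
  | Action.writeO _ => True
  | Action.left R => R.Fits κ
  | Action.right R => R.Fits κ
  | Action.reset R => R.Fits κ

/-- `p` is a program of a hypercomputer of size `M`: it has at most `M.program` instructions, its
states are ordinals `< o(M.program)` (the halting state may also be `o(M.program)`), it addresses
registers of the machine, a state other than the halting state can only be entered from a state
between the same two consecutive limit ordinals, and it is deterministic: no two different
instructions are ever applicable at the same time. -/
structure Program.Supported (M : Size.{u}) (p : Program.{u}) : Prop where
  length_le : p.length ≤ M.program.ord
  halt_le : p.halt ≤ M.program.ord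
  current_lt : ∀ i, (p.instr i).current < M.program.ord
  next_lt : ∀ i, (p.instr i).next = p.halt ∨ (p.instr i).next < M.program.ord
  source_fits : ∀ i, (p.instr i).source.toRegSet.Fits M.registers
  action_fits : ∀ i, (p.instr i).action.Fits M.registers
  accessible : ∀ i, (p.instr i).next = p.halt ∨
    (prevLim (p.instr i).current ≤ (p.instr i).next ∧
      (p.instr i).next < nextLim (p.instr i).current)
  deterministic : ∀ i j, (p.instr i).current = (p.instr j).current →
    (p.instr i).source = (p.instr j).source ∧
      ((p.instr i).symbol = (p.instr j).symbol → p.instr i = p.instr j)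

/-- A configuration: the current state, the number of the current register of each set of
registers, and the contents of all registers. -/
structure Config : Type (u + 1) where
  state : Ordinal.{u}
  head : RegSet.{u} → Ordinal.{u}
  cell : RegSet.{u} → Ordinal.{u} → Bool

/-- The initial configuration on a given input: state `0`, all current registers are number `0`,
all registers but the input registers contain `0`. -/
def Config.init (input : Ordinal.{u} → Bool) : Config.{u} where
  state := 0
  head := fun _ => 0
  cell := fun R ζ => match R with
    | RegSet.I => input ζ
    | _ => false

/-- The instruction is applicable in the configuration. -/
def Instruction.Applies (i : Instruction.{u}) (c : Config.{u}) : Prop :=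
  i.current = c.state ∧ c.cell i.source.toRegSet (c.head i.source.toRegSet) = i.symbol

open Classical in
/-- Write the symbol `s` to the current register of the set `R`. -/
def Config.write (c : Config.{u}) (R : RegSet.{u}) (s : Bool) : Config.{u} :=
  { c with cell := fun R' ζ => if R' = R ∧ ζ = c.head R then s else c.cell R' ζ }

open Classical in
/-- Make the register number `ζ` the current register of the set `R`. -/
def Config.moveTo (c : Config.{u}) (R : RegSet.{u}) (ζ : Ordinal.{u}) : Config.{u} :=
  { c with head := fun R' => if R' = R then ζ else c.head R' }

open Classical in
/-- The effect of an action, on a machine with registers number `ζ < o(κ)` in each set. A move to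
the left from a register whose number is not a successor has no effect, and neither has a move to a
register that does not exist. -/
def Action.apply (κ : Cardinal.{u}) (c : Config.{u}) : Action.{u} → Config.{u}
  | Action.nothing => c
  | Action.writeW β s => c.write (RegSet.W β) s
  | Action.writeO s => c.write RegSet.O s
  | Action.left R => c.moveTo R (Ordinal.pred (c.head R))
  | Action.right R =>
      if Order.succ (c.head R) < κ.ord then c.moveTo R (Order.succ (c.head R)) else c
  | Action.reset R => c.moveTo R 0

/-- The program has halted: it is in the halting state, or no instruction is applicable. -/
def Program.Halted (p : Program.{u}) (c : Config.{u}) : Prop :=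
  c.state = p.halt ∨ ¬ ∃ i, (p.instr i).Applies c

open Classical in
/-- One step of the program; nothing changes any more once it has halted. -/
def Program.step (M : Size.{u}) (p : Program.{u}) (c : Config.{u}) : Config.{u} :=
  if h : ¬ p.Halted c then
    let i := p.instr (not_not.mp (not_or.mp h).2).choose
    { i.action.apply M.registers c with state := i.next }
  else c

/-- `lim sup` of a sequence of ordinals at the limit ordinal `l`: the least of the upper bounds of
the final segments. -/
def limsupBelow (l : Ordinal.{u}) (f : ∀ α < l, Ordinal.{u}) : Ordinal.{u} :=
  sInf {b | ∃ α₀ < l, ∀ α, ∀ h : α < l, α₀ ≤ α → f α h ≤ b}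

open Classical in
/-- `lim sup` of a sequence of symbols at the limit ordinal `l`: it is `0` if the sequence is
constantly `0` from some point on, and `1` otherwise. -/
def limsupBit (l : Ordinal.{u}) (f : ∀ α < l, Bool) : Bool :=
  decide (∀ α₀ < l, ∃ α, ∃ h : α < l, α₀ ≤ α ∧ f α h = true)

/-- The configuration at a limit ordinal, by the `lim sup` rule. -/
def limitConfig (l : Ordinal.{u}) (c : ∀ α < l, Config.{u}) : Config.{u} where
  state := limsupBelow l fun α h => (c α h).state
  head := fun R => limsupBelow l fun α h => (c α h).head R
  cell := fun R ζ => limsupBit l fun α h => (c α h).cell R ζ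

/-- The configuration after `τ` steps of the program on the given input. -/
def Program.run (M : Size.{u}) (p : Program.{u}) (input : Ordinal.{u} → Bool) (τ : Ordinal.{u}) :
    Config.{u} :=
  Ordinal.limitRecOn τ (Config.init input) (fun _ c => p.step M c) (fun l _ c => limitConfig l c)

/-- On the given input, the program `p` of a serial hypercomputer of size `M` halts after fewer
than `o(M.time)` steps, and its output is the truth value of `q` in the output register number `0`
(`1` for true, `0` for false) and `0` in all other output registers. As the program halts of its
own accord before the time limit, the forced stop at the time limit plays no role. -/
def Program.Answers (M : Size.{u}) (p : Program.{u}) (input : Ordinal.{u} → Bool) (q : Prop) :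
    Prop :=
  ∃ τ < M.time.ord, p.Halted (p.run M input τ) ∧
    ∀ ζ < M.registers.ord, (p.run M input τ).cell RegSet.O ζ = true ↔ (ζ = 0 ∧ q)

/-! ### Sets and bits -/

/-- The binary sequence `b`, of length `o(κ) * o(κ)` (followed by zeros only), represents the set
`x` together with all its members, the members of the members and so on: there are sets `f i`,
`i < o(κ)`, with `f 0 = x`, such that the members of `f i` are the sets `f j` for which the bit
number `o(κ) * i + j` is `1`. -/
def Codes (κ : Cardinal.{u}) (b : Ordinal.{u} → Bool) (x : ZFSet.{u}) : Prop :=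
  (∀ k, κ.ord * κ.ord ≤ k → b k = false) ∧
    ∃ f : Ordinal.{u} → ZFSet.{u}, f 0 = x ∧
      ∀ i < κ.ord, ∀ z, z ∈ f i ↔ ∃ j < κ.ord, b (κ.ord * i + j) = true ∧ z = f j

/-- The set `x` requires `≤ κ` bits of information to define, for an infinite cardinal `κ`: it is
represented by a binary sequence whose length has cardinality `κ`. -/
def Bits (κ : Cardinal.{u}) (x : ZFSet.{u}) : Prop :=
  ∃ b, Codes κ b x

/-! ### First-order and second-order propositions of set theory -/

/-- First-order formulas of set theory, with variables `x₀, x₁, …` and names for specific sets, the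
names being the elements of `ν`. The other connectives and `∃` are the usual abbreviations. -/
inductive FOFormula (ν : Type) : Type
  | eq (i j : ℕ) : FOFormula ν
  | mem (i j : ℕ) : FOFormula ν
  | memName (i : ℕ) (k : ν) : FOFormula ν
  | neg (φ : FOFormula ν) : FOFormula ν
  | and (φ ψ : FOFormula ν) : FOFormula ν
  | all (i : ℕ) (φ : FOFormula ν) : FOFormula ν

/-- Truth of a first-order formula, for a given interpretation `A` of the names and a given
assignment `v` of values to the variables, where the quantifiers range over the sets in `D`. -/
def FOFormula.Holds {ν : Type} (D : Set ZFSet.{u}) (A : ν → ZFSet.{u}) :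
    FOFormula ν → (ℕ → ZFSet.{u}) → Prop
  | .eq i j, v => v i = v j
  | .mem i j, v => v i ∈ v j
  | .memName i k, v => v i ∈ A k
  | .neg φ, v => ¬ φ.Holds D A v
  | .and φ ψ, v => φ.Holds D A v ∧ ψ.Holds D A v
  | .all i φ, v => ∀ x ∈ D, φ.Holds D A (Function.update v i x)

/-- The Gödel number of a first-order formula. -/
def FOFormula.number {ν : Type} [Encodable ν] : FOFormula ν → ℕ
  | .eq i j => Nat.pair 0 (Nat.pair i j)
  | .mem i j => Nat.pair 1 (Nat.pair i j)
  | .memName i k => Nat.pair 2 (Nat.pair i (Encodable.encode k))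
  | .neg φ => Nat.pair 3 φ.number
  | .and φ ψ => Nat.pair 4 (Nat.pair φ.number ψ.number)
  | .all i φ => Nat.pair 5 (Nat.pair i φ.number)

/-- Second-order formulas of set theory, with first-order variables `x₀, x₁, …` for sets and
second-order variables `X₀, X₁, …` for sets of such sets. (As ordered pairs are sets, no further
variables for relations are needed.) The other connectives and `∃` are the usual abbreviations. -/
inductive SOFormula : Type
  | eq (i j : ℕ) : SOFormula
  | mem (i j : ℕ) : SOFormula
  | memVar (i j : ℕ) : SOFormula
  | neg (φ : SOFormula) : SOFormula
  | and (φ ψ : SOFormula) : SOFormula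
  | all (i : ℕ) (φ : SOFormula) : SOFormula
  | allSet (j : ℕ) (φ : SOFormula) : SOFormula

/-- Truth of a second-order formula under assignments `v` to the first-order and `V` to the
second-order variables, where the first-order quantifiers range over the sets in `D` and the
second-order quantifiers over all sets of sets in `D`. -/
def SOFormula.Holds (D : Set ZFSet.{u}) :
    SOFormula → (ℕ → ZFSet.{u}) → (ℕ → ZFSet.{u}) → Prop
  | .eq i j, v, _ => v i = v j
  | .mem i j, v, _ => v i ∈ v j
  | .memVar i j, v, V => v i ∈ V j
  | .neg φ, v, V => ¬ φ.Holds D v V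
  | .and φ ψ, v, V => φ.Holds D v V ∧ ψ.Holds D v V
  | .all i φ, v, V => ∀ x ∈ D, φ.Holds D (Function.update v i x) V
  | .allSet j φ, v, V =>
      ∀ X : ZFSet.{u}, (∀ x ∈ X, x ∈ D) → φ.Holds D v (Function.update V j X)

/-- The Gödel number of a second-order formula. -/
def SOFormula.number : SOFormula → ℕ
  | .eq i j => Nat.pair 0 (Nat.pair i j)
  | .mem i j => Nat.pair 1 (Nat.pair i j)
  | .memVar i j => Nat.pair 2 (Nat.pair i j)
  | .neg φ => Nat.pair 3 φ.number
  | .and φ ψ => Nat.pair 4 (Nat.pair φ.number ψ.number)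
  | .all i φ => Nat.pair 5 (Nat.pair i φ.number)
  | .allSet j φ => Nat.pair 6 (Nat.pair j φ.number)

/-! ### Presentation of a proposition as input -/

/-- Interleave countably many binary sequences: the register number `ω * i + n` contains the bit
number `i` of the sequence number `n`. -/
def interleave (s : ℕ → Ordinal.{u} → Bool) : Ordinal.{u} → Bool :=
  fun ρ => s (Cardinal.toNat (ρ % ω).card) (ρ / ω)

open Classical in
/-- The binary sequence whose only `1` is the bit number `g`. -/
def unary (g : ℕ) : Ordinal.{u} → Bool :=
  fun i => decide (i = g)

/-- The input that presents a formula, by its Gödel number `g`, and the values of its free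
first-order variables, by binary sequences `b 0, b 1, …` that represent them. -/
def inputFO (g : ℕ) (b : ℕ → Ordinal.{u} → Bool) : Ordinal.{u} → Bool :=
  interleave fun n => match n with
    | 0 => unary g
    | n + 1 => b n

/-- The input that presents a formula, by its Gödel number `g`, and the values of its free
first-order and second-order variables, by binary sequences `b n` and `B n` that represent them. -/
def inputSO (g : ℕ) (b B : ℕ → Ordinal.{u} → Bool) : Ordinal.{u} → Bool :=
  interleave fun n =>
    if n = 0 then unary g else if n % 2 = 1 then b (n / 2) else B (n / 2 - 1)

end Hypercomputer

end

/-!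
A program may have as many instructions as there are inputs, and this is what makes the theorem
true. A value in `D` is given by `κ` bits and a formula by a number, so the presented propositions
are binary sequences of one fixed length `L` of cardinality `κ`; for second-order propositions the
same holds with `2 ^ κ` in place of `κ`. Write `μ` for this cardinal. There are only `N = 2 ^ μ`
such sequences, and each has a definite truth value, because the Gödel number determines the formula
(`FOFormula.number_injective`, `SOFormula.number_injective`) and a representing sequence determines
the set (`Codes.unique`: the coded membership relation is well-founded, being mapped into `∈`).
The named sets `A k` are fixed before the program is chosen, so the table may depend on them.

Hence a program of length `o(N)` can contain a table of all inputs, in the order type `o(N)`, with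
their truth values (`lookupProgram`). It compares its input with the entries of the table, one after
the other, and stops with the truth value of the first entry that agrees. An input that occurs at
place `α < o(N)` is recognized after at most `(2 + L + 1) * (α + 1)` steps, which is fewer than
`o(N)`, since `o(N)` is closed under multiplication. A search through all the `N` values of a
quantified variable would not meet this time limit; the table replaces it.

Control is as simple as it can be: until the program halts, its state equals the number of steps
made so far. This respects the condition that the state stays between two consecutive limit
ordinals, and it is preserved by the `lim sup` rule. The outcome of a comparison therefore cannot be
kept in the state; it is kept as a flag, in register `0` of `W 0`, as `scan` makes precise.
-/

noncomputable section

namespace Hypercomputer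

/-! ### Limits -/

theorem limsupBelow_eq {l v : Ordinal.{u}} {f : ∀ α < l, Ordinal.{u}}
    (hle : ∃ α₀ < l, ∀ α, ∀ h : α < l, α₀ ≤ α → f α h ≤ v)
    (hlt : ∀ w < v, ∀ α₀ < l, ∃ α, ∃ h : α < l, α₀ ≤ α ∧ w < f α h) :
    limsupBelow l f = v := by
  refine le_antisymm (csInf_le' hle) (le_csInf ⟨v, hle⟩ ?_)
  rintro b ⟨α₀, hα₀, hb⟩
  by_contra! hbv
  obtain ⟨α, h, hα, hlt⟩ := hlt b hbv α₀ hα₀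
  exact (hb α h hα).not_gt hlt

theorem limsupBelow_const {l v : Ordinal.{u}} {f : ∀ α < l, Ordinal.{u}} (hl : 0 < l)
    (hf : ∀ α, ∀ h : α < l, f α h = v) : limsupBelow l f = v :=
  limsupBelow_eq ⟨0, hl, fun α h _ => (hf α h).le⟩
    fun _ hw α₀ h₀ => ⟨α₀, h₀, le_rfl, hw.trans_eq (hf α₀ h₀).symm⟩

theorem limsupBit_eq {l : Ordinal.{u}} {v : Bool} {f : ∀ α < l, Bool}
    (hf : ∃ α₀ < l, ∀ α, ∀ h : α < l, α₀ ≤ α → f α h = v) : limsupBit l f = v := by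
  obtain ⟨α₀, h₀, hf⟩ := hf
  cases v
  · simp only [limsupBit, decide_eq_false_iff_not]
    intro H
    obtain ⟨α, h, hα, hv⟩ := H α₀ h₀
    simp [hf α h hα] at hv
  · simp only [limsupBit, decide_eq_true_eq]
    exact fun β hβ => ⟨max α₀ β, max_lt h₀ hβ, le_max_right _ _, hf _ _ (le_max_left _ _)⟩

section Run

variable (M : Size.{u}) (p : Program.{u}) (x : Ordinal.{u} → Bool)

theorem Program.run_zero : p.run M x 0 = Config.init x :=
  Ordinal.limitRecOn_zero ..

theorem Program.run_add_one (τ : Ordinal.{u}) : p.run M x (τ + 1) = p.step M (p.run M x τ) :=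
  Ordinal.limitRecOn_add_one ..

theorem Program.run_limit {l : Ordinal.{u}} (hl : Order.IsSuccLimit l) :
    p.run M x l = limitConfig l fun τ _ => p.run M x τ :=
  Ordinal.limitRecOn_limit _ _ _ _ hl

end Run

/-! ### The table of all inputs -/

theorem exists_table {N : Cardinal.{u}} {L : Ordinal.{u}} (h : 2 ^ L.card ≤ N) :
    ∃ T : Ordinal.{u} → Ordinal.{u} → Bool, ∀ x : Ordinal.{u} → Bool,
      (∀ ρ, L ≤ ρ → x ρ = false) → ∃ α < N.ord, T α = x := by
  let S : Set (Ordinal.{u} → Bool) := {x | ∀ ρ, L ≤ ρ → x ρ = false}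
  let r : S → (Set.Iio L → Bool) := fun x ρ => x.1 ρ
  have hr : Function.Injective r := by
    intro x y hxy
    refine Subtype.ext (funext fun ρ => ?_)
    rcases lt_or_ge ρ L with hρ | hρ
    · exact congrFun hxy ⟨ρ, hρ⟩
    · rw [x.2 ρ hρ, y.2 ρ hρ]
  have hS : #S ≤ #(Set.Iio N.ord) := by
    refine (Cardinal.mk_le_of_injective hr).trans ?_
    rw [Cardinal.mk_arrow, Cardinal.mk_bool, Cardinal.lift_two, Cardinal.lift_uzero,
      Cardinal.mk_Iio_ordinal, Cardinal.mk_Iio_ordinal, Cardinal.card_ord,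
      ← Cardinal.lift_two.{u + 1, u}, ← Cardinal.lift_power, Cardinal.lift_le]
    exact h
  obtain ⟨g⟩ := hS
  have hg : Function.Injective fun s : S => (g s).1 :=
    Subtype.val_injective.comp g.injective
  exact ⟨Function.extend (fun s : S => (g s).1) Subtype.val fun _ _ => false,
    fun x hx => ⟨_, (g ⟨x, hx⟩).2, hg.extend_apply _ _ (⟨x, hx⟩ : S)⟩⟩

/-! ### The look-up program -/

/-- The readable register set of the look-up program in the state `σ`. The states are divided into
passes of length `2 + L + 1`. A pass reads the input, except in its last step, where it reads its
flag, which is the register number `0` of `W 0`. -/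
def lookupSource (L σ : Ordinal.{u}) : ReadSet.{u} :=
  if σ % (2 + L + 1) = 2 + L then .W 0 else .I

/-- The action of the look-up program in the state `σ` on the symbol `b`. The `α`-th pass compares
the first `L` bits of the input with the entry `T α` of the table. It returns to the first input
register, clears the flag, and then compares one bit in each step: if it agrees, the next input
register becomes the current one; otherwise the flag is raised. (After that the input head lags
behind, but this is of no importance, as the flag is not cleared again in the same pass.) If the
flag is down at the end of the pass, then `Q α` is the output. -/
def lookupAction (L : Ordinal.{u}) (T : Ordinal.{u} → Ordinal.{u} → Bool)
    (Q : Ordinal.{u} → Bool) (σ : Ordinal.{u}) (b : Bool) : Action.{u} :=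
  if σ % (2 + L + 1) = 0 then .reset .I
  else if σ % (2 + L + 1) = 1 then .writeW 0 false
  else if σ % (2 + L + 1) = 2 + L then
    if b = false then .writeO (Q (σ / (2 + L + 1))) else .nothing
  else if b = T (σ / (2 + L + 1)) (σ % (2 + L + 1) - 2) then .right .I
  else .writeW 0 true

/-- The instruction of the look-up program for the state `σ` and the symbol `b`. The next state is
`σ + 1`, unless the flag is down at the end of a pass: then the program halts. -/
def lookupInstr (N : Cardinal.{u}) (L : Ordinal.{u}) (T : Ordinal.{u} → Ordinal.{u} → Bool)
    (Q : Ordinal.{u} → Bool) (σ : Ordinal.{u}) (b : Bool) : Instruction.{u} where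
  current := σ
  source := lookupSource L σ
  symbol := b
  action := lookupAction L T Q σ b
  next := if σ % (2 + L + 1) = 2 + L ∧ b = false then N.ord else σ + 1

/-- The look-up program. Its instructions number `2 * σ` and `2 * σ + 1` are those for the state `σ`
and the symbols `0` and `1`. -/
def lookupProgram (N : Cardinal.{u}) (L : Ordinal.{u}) (T : Ordinal.{u} → Ordinal.{u} → Bool)
    (Q : Ordinal.{u} → Bool) : Program.{u} where
  length := N.ord
  instr := fun i => lookupInstr N L T Q (i.1 / 2) (decide (i.1 % 2 = 1))
  halt := N.ord

section Lookup

variable {N : Cardinal.{u}} {L : Ordinal.{u}} {T : Ordinal.{u} → Ordinal.{u} → Bool}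
  {Q : Ordinal.{u} → Bool}

theorem lookupInstr_next (σ : Ordinal.{u}) (b : Bool) :
    (lookupInstr N L T Q σ b).next = N.ord ∨ (lookupInstr N L T Q σ b).next = σ + 1 := by
  unfold lookupInstr; split_ifs <;> simp

theorem div_two_lt {i : Ordinal.{u}} (hi : i < N.ord) : i / 2 < N.ord :=
  (Ordinal.div_le_of_le_mul (le_mul_right i two_pos)).trans_lt hi

theorem add_one_lt_nextLim (σ : Ordinal.{u}) : σ + 1 < nextLim σ := by
  have h : σ % ω + 1 < ω := isSuccLimit_omega0.add_one_lt (mod_lt _ omega0_ne_zero)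
  calc σ + 1 = ω * (σ / ω) + (σ % ω + 1) := by rw [← add_assoc, div_add_mod]
    _ < nextLim σ := (add_lt_add_iff_left _).2 h

theorem lookupProgram_supported (hN : ℵ₀ ≤ N) :
    (lookupProgram N L T Q).Supported (Size.uniform N) where
  length_le := le_rfl
  halt_le := le_rfl
  current_lt i := div_two_lt i.2
  next_lt i := (lookupInstr_next (i.1 / 2) _).imp id fun h =>
    h.trans_lt ((isSuccLimit_ord hN).add_one_lt (div_two_lt i.2))
  source_fits i := by
    have h0 : 0 < N.ord := (isSuccLimit_ord hN).bot_lt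
    simp only [lookupProgram, lookupInstr, lookupSource]
    split_ifs <;> simp [ReadSet.toRegSet, RegSet.Fits, Size.uniform, h0]
  action_fits i := by
    have h0 : 0 < N.ord := (isSuccLimit_ord hN).bot_lt
    simp only [lookupProgram, lookupInstr, lookupAction]
    split_ifs <;> simp [Action.Fits, RegSet.Fits, Size.uniform, h0]
  accessible i := (lookupInstr_next (i.1 / 2) _).imp id fun h =>
    ⟨((mul_div_le _ _).trans le_self_add).trans_eq h.symm, h.trans_lt (add_one_lt_nextLim _)⟩
  deterministic i j h := by
    simp only [lookupProgram, lookupInstr] at h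
    simp only [lookupProgram, lookupInstr, h]
    exact ⟨trivial, fun hs => by rw [hs]⟩

theorem two_lt_ord (hN : ℵ₀ ≤ N) : 2 < N.ord := by
  simpa using (natCast_lt_omega0 2).trans_le (omega0_le_ord.2 hN)

theorem lookupProgram_step (hN : ℵ₀ ≤ N) {c : Config.{u}} {σ : Ordinal.{u}} (hc : c.state = σ)
    (hσ : σ < N.ord) {b : Bool}
    (hb : c.cell (lookupSource L σ).toRegSet (c.head (lookupSource L σ).toRegSet) = b) :
    (lookupProgram N L T Q).step (Size.uniform N) c =
      { (lookupAction L T Q σ b).apply N c with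
        state := if σ % (2 + L + 1) = 2 + L ∧ b = false then N.ord else σ + 1 } := by
  have hbit : (if b then 1 else 0 : Ordinal.{u}) < 2 := by
    split_ifs
    exacts [_root_.one_lt_two, two_pos]
  have hex : ∃ i, ((lookupProgram N L T Q).instr i).Applies c := by
    refine ⟨⟨2 * σ + (if b then 1 else 0), isPrincipal_add_ord hN
      (isPrincipal_mul_ord hN (two_lt_ord hN) hσ) (hbit.trans (two_lt_ord hN))⟩, ?_⟩
    simp only [lookupProgram, Instruction.Applies, lookupInstr, mul_add_mod_self,
      mul_add_div _ two_ne_zero, div_eq_zero_of_lt hbit, mod_eq_of_lt hbit, add_zero, hc, hb,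
      true_and]
    cases b <;> simp
  have hnh : ¬ (lookupProgram N L T Q).Halted c := by
    rintro (h | h)
    · exact hσ.ne (hc.symm.trans h)
    · exact h hex
  have key : ∀ i, ((lookupProgram N L T Q).instr i).Applies c →
      (lookupProgram N L T Q).instr i = lookupInstr N L T Q σ b := by
    rintro i ⟨h₁, h₂⟩
    simp only [lookupProgram, lookupInstr, hc] at h₁ h₂
    rw [h₁, hb] at h₂
    simp only [lookupProgram, h₁, ← h₂]
  rw [Program.step, dif_pos hnh]
  simp only [key _ (not_not.mp (not_or.mp hnh).2).choose_spec]
  rfl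

/-! ### Runs of the look-up program -/

/-- What holds of the configuration after `τ` steps on the input `x`, as long as the program has not
halted: the state is `τ`, the flag and the output register number `0` are the current registers, the
input is unchanged, and there is no output. -/
structure Running (x : Ordinal.{u} → Bool) (τ : Ordinal.{u}) (c : Config.{u}) : Prop where
  state : c.state = τ
  headW : c.head (.W 0) = 0
  headO : c.head .O = 0
  cellI : ∀ ζ, c.cell .I ζ = x ζ
  cellO : ∀ ζ, c.cell .O ζ = false

variable {x : Ordinal.{u} → Bool}

local notation "C" => Program.run (Size.uniform N) (lookupProgram N L T Q) x

theorem running_zero : Running x 0 (C 0) := by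
  rw [Program.run_zero]
  constructor <;> simp [Config.init]

theorem running_limit {l : Ordinal.{u}} (hl : Order.IsSuccLimit l)
    (h : ∀ τ < l, Running x τ (C τ)) : Running x l (C l) := by
  rw [Program.run_limit _ _ _ hl]
  have h0 : 0 < l := hl.bot_lt
  refine ⟨limsupBelow_eq ⟨0, h0, fun α hα _ => (h α hα).state.trans_le hα.le⟩ ?_,
    limsupBelow_const h0 fun α hα => (h α hα).headW,
    limsupBelow_const h0 fun α hα => (h α hα).headO,
    fun ζ => limsupBit_eq ⟨0, h0, fun α hα _ => (h α hα).cellI ζ⟩,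
    fun ζ => limsupBit_eq ⟨0, h0, fun α hα _ => (h α hα).cellO ζ⟩⟩
  intro w hw α₀ h₀
  have hlt := max_lt hw h₀
  refine ⟨max w α₀ + 1, hl.add_one_lt hlt, (le_max_right w α₀).trans le_self_add, ?_⟩
  rw [(h _ (hl.add_one_lt hlt)).state]
  exact (le_max_left w α₀).trans_lt (lt_add_one _)

theorem run_add_one (hN : ℵ₀ ≤ N) {σ : Ordinal.{u}} (hσ : σ < N.ord) (h : Running x σ (C σ))
    {b : Bool}
    (hb : (C σ).cell (lookupSource L σ).toRegSet ((C σ).head (lookupSource L σ).toRegSet) = b) :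
    C (σ + 1) =
      { (lookupAction L T Q σ b).apply N (C σ) with
        state := if σ % (2 + L + 1) = 2 + L ∧ b = false then N.ord else σ + 1 } := by
  rw [Program.run_add_one, lookupProgram_step hN h.state hσ hb]

theorem running_add_one (hN : ℵ₀ ≤ N) {σ : Ordinal.{u}} (hσ : σ < N.ord)
    (h : Running x σ (C σ))
    (hflag : σ % (2 + L + 1) = 2 + L → (C σ).cell (.W 0) 0 = true) :
    Running x (σ + 1) (C (σ + 1)) := by
  have hb : σ % (2 + L + 1) = 2 + L →
      (C σ).cell (lookupSource L σ).toRegSet ((C σ).head (lookupSource L σ).toRegSet) = true := by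
    intro hmod
    simp only [lookupSource, if_pos hmod, ReadSet.toRegSet, h.headW, hflag hmod]
  rw [run_add_one hN hσ h rfl]
  generalize (C σ).cell _ _ = b at hb ⊢
  constructor
  · exact if_neg fun H => by simp [hb H.1] at H
  all_goals
    simp only [lookupAction]
    split_ifs
  all_goals
    simp_all [Action.apply, Config.moveTo, Config.write, h.headW, h.headO, h.cellI, h.cellO]
    try split_ifs
  all_goals simp [h.headW, h.headO, h.cellI, h.cellO]

theorem pass_end_lt {α : Ordinal.{u}} (hN : ℵ₀ ≤ N) (hL : L < N.ord) (hα : α < N.ord) :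
    (2 + L + 1) * α + (2 + L) + 1 < N.ord := by
  have h2L : 2 + L < N.ord := isPrincipal_add_ord hN (two_lt_ord hN) hL
  have hs := isSuccLimit_ord hN
  exact hs.add_one_lt
    (isPrincipal_add_ord hN (isPrincipal_mul_ord hN (hs.add_one_lt h2L) hα) h2L)

theorem mod_pass (α : Ordinal.{u}) {ξ : Ordinal.{u}} (hξ : ξ ≤ 2 + L) :
    ((2 + L + 1) * α + ξ) % (2 + L + 1) = ξ := by
  rw [mul_add_mod_self, mod_eq_of_lt (hξ.trans_lt (lt_add_one _))]

theorem div_pass (α : Ordinal.{u}) {ξ : Ordinal.{u}} (hξ : ξ ≤ 2 + L) :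
    ((2 + L + 1) * α + ξ) / (2 + L + 1) = α := by
  have h := hξ.trans_lt (lt_add_one _)
  rw [mul_add_div _ (bot_le.trans_lt h).ne', div_eq_zero_of_lt h, add_zero]

/-- During the `α`-th pass, after the comparison of `η` bits, the flag is up if and only if one of
them has been different, and the input head is at `η` if the flag is down. -/
theorem scan (hN : ℵ₀ ≤ N) (hL : L < N.ord) {α : Ordinal.{u}} (hα : α < N.ord)
    {η : Ordinal.{u}} (hη : η ≤ L)
    (h : ∀ τ < (2 + L + 1) * α + (2 + η), Running x τ (C τ)) :
    ((C ((2 + L + 1) * α + (2 + η))).cell (.W 0) 0 = true ↔ ∃ ζ < η, x ζ ≠ T α ζ) ∧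
      ((∀ ζ < η, x ζ = T α ζ) → (C ((2 + L + 1) * α + (2 + η))).head .I = η) := by
  have hlt : ∀ ξ ≤ 2 + L, (2 + L + 1) * α + ξ < N.ord := fun ξ hξ =>
    (((add_le_add_iff_left _).2 hξ).trans_lt (lt_add_one _)).trans (pass_end_lt hN hL hα)
  induction η using Ordinal.limitRecOn with
  | zero =>
    have e : (2 + L + 1) * α + (2 + 0) = (2 + L + 1) * α + 1 + 1 := by
      rw [add_zero, add_assoc (_ * α), one_add_one_eq_two]
    rw [e] at h ⊢
    have h12 : (1 : Ordinal.{u}) ≤ 2 + L := one_le_two.trans le_self_add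
    have h0 := h ((2 + L + 1) * α) ((lt_add_one _).trans (lt_add_one _))
    have h1 := h _ (lt_add_one _)
    have c1 := run_add_one hN (by simpa using hlt 0 zero_le) h0 rfl
    have c2 := run_add_one hN (hlt 1 h12) h1 rfl
    have hI : (C ((2 + L + 1) * α + 1)).head .I = 0 := by
      rw [c1]
      simp [lookupAction, Action.apply, Config.moveTo]
    rw [c2]
    simp [lookupAction, mod_pass α h12, Action.apply, Config.write, h1.headW, hI]
  | add_one η ih =>
    have hηL : η < L := (lt_add_one η).trans_le hη
    have e : (2 + L + 1) * α + (2 + (η + 1)) = (2 + L + 1) * α + (2 + η) + 1 := by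
      simp only [add_assoc]
    rw [e] at h ⊢
    obtain ⟨ih₁, ih₂⟩ := ih hηL.le fun τ hτ => h τ (hτ.trans (lt_add_one _))
    have hr := h _ (lt_add_one _)
    have h2η : 2 + η < 2 + L := (add_lt_add_iff_left _).2 hηL
    have n0 : 2 + η ≠ 0 := (two_pos.trans_le le_self_add).ne'
    have n1 : 2 + η ≠ 1 := (_root_.one_lt_two.trans_le le_self_add).ne'
    have c := run_add_one hN (hlt _ h2η.le) hr rfl
    simp only [lookupAction, lookupSource, mod_pass α h2η.le, div_pass α h2η.le,
      Ordinal.add_sub_cancel, if_neg n0, if_neg n1, if_neg h2η.ne, ReadSet.toRegSet, hr.cellI] at c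
    have hW := hr.headW
    set c₀ := C ((2 + L + 1) * α + (2 + η)) with hc₀
    by_cases hag : ∀ ζ < η, x ζ = T α ζ
    · have hhead := ih₂ hag
      have hcell : c₀.cell (.W 0) 0 = false := by
        rw [← Bool.not_eq_true, ih₁]
        push Not
        exact hag
      have hηN : η + 1 < N.ord := (isSuccLimit_ord hN).add_one_lt (hηL.trans hL)
      rw [hhead] at c
      by_cases hbit : x η = T α η
      · have hag' : ∀ ζ < η + 1, x ζ = T α ζ := fun ζ hζ =>
          (Order.lt_add_one_iff.1 hζ).lt_or_eq.elim (hag ζ) fun hζ => hζ ▸ hbit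
        rw [if_pos hbit] at c
        rw [c]
        refine ⟨iff_of_false ?_ ?_, fun _ => ?_⟩
        · simp [Action.apply, hhead, hηN, Config.moveTo, hcell]
        · push Not
          exact hag'
        · simp [Action.apply, hhead, hηN, Config.moveTo]
      · rw [if_neg hbit] at c
        rw [c]
        refine ⟨iff_of_true ?_ ⟨η, lt_add_one η, hbit⟩,
          fun H => absurd (H η (lt_add_one η)) hbit⟩
        simp [Action.apply, Config.write, hW]
    · push Not at hag
      have hcell := ih₁.2 hag
      obtain ⟨ζ, hζ, hne⟩ := hag
      refine ⟨iff_of_true ?_ ⟨ζ, hζ.trans (lt_add_one η), hne⟩,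
        fun H => absurd (H ζ (hζ.trans (lt_add_one η))) hne⟩
      rw [c]
      split_ifs <;> simp only [Action.apply] <;> (try split_ifs) <;>
        simp [Config.moveTo, Config.write, hW, hcell]
  | limit η hlim ih =>
    have hl : Order.IsSuccLimit ((2 + L + 1) * α + (2 + η)) :=
      isSuccLimit_add _ (isSuccLimit_add _ hlim)
    have ih' : ∀ θ < η, _ := fun θ hθ => ih θ hθ (hθ.le.trans hη) fun τ hτ =>
      h τ (hτ.trans ((add_lt_add_iff_left _).2 ((add_lt_add_iff_left _).2 hθ)))
    -- The steps of this pass that precede the limit are those of the comparisons `θ < η`.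
    have key : ∀ θ₀, ∀ τ < (2 + L + 1) * α + (2 + η), (2 + L + 1) * α + (2 + θ₀) ≤ τ →
        ∃ θ < η, θ₀ ≤ θ ∧ τ = (2 + L + 1) * α + (2 + θ) := by
      intro θ₀ τ hτ hle
      have e : τ = (2 + L + 1) * α + (2 + θ₀) + (τ - ((2 + L + 1) * α + (2 + θ₀))) :=
        (Ordinal.add_sub_cancel_of_le hle).symm
      have e' : τ = (2 + L + 1) * α + (2 + (θ₀ + (τ - ((2 + L + 1) * α + (2 + θ₀))))) := by
        rw [← add_assoc 2, ← add_assoc, ← e]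
      refine ⟨_, ?_, le_self_add, e'⟩
      rw [e'] at hτ
      exact (add_lt_add_iff_left _).1 ((add_lt_add_iff_left _).1 hτ)
    have hmono : ∀ θ < η, (2 + L + 1) * α + (2 + θ) < (2 + L + 1) * α + (2 + η) := fun θ hθ =>
      (add_lt_add_iff_left _).2 ((add_lt_add_iff_left _).2 hθ)
    rw [Program.run_limit _ _ _ hl]
    by_cases hag : ∀ ζ < η, x ζ = T α ζ
    · have hη0 : 0 < η := hlim.bot_lt
      refine ⟨iff_of_false ?_ (by push Not; exact hag), fun _ => ?_⟩
      · rw [Bool.not_eq_true]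
        refine limsupBit_eq ⟨_, hmono 0 hη0, fun τ hτ hle => ?_⟩
        obtain ⟨θ, hθ, -, rfl⟩ := key 0 τ hτ hle
        rw [← Bool.not_eq_true, (ih' θ hθ).1]
        push Not
        exact fun ζ hζ => hag ζ (hζ.trans hθ)
      · have hhead : ∀ θ < η, (C ((2 + L + 1) * α + (2 + θ))).head .I = θ := fun θ hθ =>
          (ih' θ hθ).2 fun ζ hζ => hag ζ (hζ.trans hθ)
        refine limsupBelow_eq ⟨_, hmono 0 hη0, fun τ hτ hle => ?_⟩ fun w hw τ hτ => ?_
        · obtain ⟨θ, hθ, -, rfl⟩ := key 0 τ hτ hle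
          exact (hhead θ hθ).trans_le hθ.le
        · have hw' := hlim.add_one_lt hw
          obtain ⟨θ, hθ, hle, e⟩ := key (w + 1) _ (max_lt hτ (hmono _ hw')) (le_max_right _ _)
          refine ⟨_, hmono θ hθ, e ▸ le_max_left _ _, ?_⟩
          rw [hhead θ hθ]
          exact (lt_add_one w).trans_le hle
    · push Not at hag
      obtain ⟨ζ, hζ, hne⟩ := hag
      refine ⟨iff_of_true ?_ ⟨ζ, hζ, hne⟩, fun H => absurd (H ζ hζ) hne⟩
      have hζ' := hlim.add_one_lt hζ
      refine limsupBit_eq ⟨_, hmono _ hζ', fun τ hτ hle => ?_⟩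
      obtain ⟨θ, hθ, hle', rfl⟩ := key _ τ hτ hle
      exact (ih' θ hθ).1.2 ⟨ζ, (lt_add_one ζ).trans_le hle', hne⟩

/-- The look-up program answers the proposition that belongs to its input. -/
theorem lookupProgram_answers (hN : ℵ₀ ≤ N) (hL : L < N.ord) {q : Prop}
    (hT : ∃ α < N.ord, ∀ ζ < L, x ζ = T α ζ)
    (hQ : ∀ α < N.ord, (∀ ζ < L, x ζ = T α ζ) → (Q α = true ↔ q)) :
    (lookupProgram N L T Q).Answers (Size.uniform N) x q := by
  -- The program halts in the pass of the first entry that agrees with the input.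
  obtain ⟨α, ⟨hα, hag⟩, hmin⟩ := WellFounded.has_min Ordinal.lt_wf
    {α | α < N.ord ∧ ∀ ζ < L, x ζ = T α ζ} hT
  have hend := pass_end_lt hN hL hα
  have hrun : ∀ τ ≤ (2 + L + 1) * α + (2 + L), Running x τ (C τ) := by
    intro τ
    induction τ using WellFoundedLT.induction with
    | ind τ ih =>
    intro hτ
    rcases Ordinal.zero_or_succ_or_isSuccLimit τ with rfl | ⟨σ, rfl⟩ | hlim
    · exact running_zero
    · have hσ : σ < (2 + L + 1) * α + (2 + L) := (lt_add_one σ).trans_le hτ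
      have hσN : σ < N.ord := (hσ.trans (lt_add_one _)).trans hend
      refine running_add_one hN hσN (ih σ (lt_add_one σ) hσ.le) fun hmod => ?_
      have e : (2 + L + 1) * (σ / (2 + L + 1)) + (2 + L) = σ := by
        conv_rhs => rw [← div_add_mod σ (2 + L + 1), hmod]
      have hdiv : σ / (2 + L + 1) < α := by
        rw [← e] at hσ
        by_contra! hle
        exact hσ.not_ge (add_le_add (mul_le_mul_right hle _) le_rfl)
      have hs := (scan (T := T) (Q := Q) (x := x) hN hL (hdiv.trans hα) le_rfl fun τ hτ' => by
        rw [e] at hτ'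
        exact ih τ (hτ'.trans (lt_add_one σ)) (hτ'.trans hσ).le).1
      rw [e] at hs
      rw [hs]
      by_contra! H
      exact hmin _ ⟨hdiv.trans hα, H⟩ hdiv
    · exact running_limit hlim fun σ hσ => ih σ hσ (hσ.le.trans hτ)
  have hr := hrun _ le_rfl
  have hflag : (C ((2 + L + 1) * α + (2 + L))).cell (.W 0) 0 = false := by
    rw [← Bool.not_eq_true, (scan hN hL hα le_rfl fun τ hτ => hrun τ hτ.le).1]
    push Not
    exact hag
  have n0 : 2 + L ≠ 0 := (two_pos.trans_le le_self_add).ne'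
  have n1 : 2 + L ≠ 1 := (_root_.one_lt_two.trans_le le_self_add).ne'
  have hmod := mod_pass α (le_refl (2 + L))
  have c := run_add_one (b := false) hN ((lt_add_one _).trans hend) hr (by
    simp only [lookupSource, if_pos hmod, ReadSet.toRegSet, hr.headW, hflag])
  simp only [lookupAction, hmod, div_pass α (le_refl (2 + L)), if_neg n0, if_neg n1, if_true,
    and_self] at c
  refine ⟨_, hend, .inl ?_, fun ζ _ => ?_⟩
  · rw [c]
    rfl
  · rw [c, ← hQ α hα hag]
    simp [Action.apply, Config.write, hr.headO, hr.cellO]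

end Lookup

/-- Any assignment of truth values to the inputs of a fixed length of cardinality `≤ μ` is answered
by a program of a hypercomputer of size `⟨2 ^ μ, 2 ^ μ, 2 ^ μ⟩`. -/
theorem exists_program_answers {μ : Cardinal.{u}} (hμ : ℵ₀ ≤ μ) {L : Ordinal.{u}}
    (hL : L.card ≤ μ) (q : (Ordinal.{u} → Bool) → Prop) :
    ∃ p : Program.{u}, p.Supported (Size.uniform (2 ^ μ)) ∧
      ∀ x : Ordinal.{u} → Bool, (∀ ρ, L ≤ ρ → x ρ = false) →
        p.Answers (Size.uniform (2 ^ μ)) x (q x) := by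
  classical
  have hN : ℵ₀ ≤ (2 : Cardinal.{u}) ^ μ := hμ.trans (cantor μ).le
  obtain ⟨T, hT⟩ := exists_table (N := 2 ^ μ) (L := L) (power_le_power_left two_ne_zero hL)
  -- Only the first `L` bits of an entry of the table are compared with the input.
  let cut : (Ordinal.{u} → Bool) → Ordinal.{u} → Bool := fun y ρ => if ρ < L then y ρ else false
  refine ⟨lookupProgram (2 ^ μ) L T fun α => decide (q (cut (T α))),
    lookupProgram_supported hN, fun x hx => ?_⟩
  refine lookupProgram_answers hN (lt_ord.2 (hL.trans_lt (cantor μ))) ?_ fun α _ hag => ?_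
  · obtain ⟨α, hα, rfl⟩ := hT x hx
    exact ⟨α, hα, fun _ _ => rfl⟩
  · have : cut (T α) = x := by
      funext ρ
      by_cases hρ : ρ < L
      · simp only [cut, if_pos hρ, hag ρ hρ]
      · simp only [cut, if_neg hρ, hx ρ (not_lt.1 hρ)]
    simp only [this, decide_eq_true_eq]

/-! ### The input determines the proposition -/

theorem Codes.unique {κ : Cardinal.{u}} (hκ : ℵ₀ ≤ κ) {b : Ordinal.{u} → Bool} {x y : ZFSet.{u}}
    (hx : Codes κ b x) (hy : Codes κ b y) : x = y := by
  obtain ⟨-, f, rfl, hf⟩ := hx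
  obtain ⟨-, g, rfl, hg⟩ := hy
  have key : ∀ z : ZFSet.{u}, ∀ i < κ.ord, f i = z → f i = g i := by
    intro z
    induction z using ZFSet.inductionOn with
    | _ z ih =>
    rintro i hi rfl
    have hfg : ∀ j < κ.ord, b (κ.ord * i + j) = true → f j = g j := fun j hj hb =>
      ih (f j) ((hf i hi _).2 ⟨j, hj, hb, rfl⟩) j hj rfl
    ext w
    rw [hf i hi, hg i hi]
    constructor
    · rintro ⟨j, hj, hb, rfl⟩
      exact ⟨j, hj, hb, hfg j hj hb⟩
    · rintro ⟨j, hj, hb, rfl⟩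
      exact ⟨j, hj, hb, (hfg j hj hb).symm⟩
  exact key _ 0 (isSuccLimit_ord hκ).bot_lt rfl

theorem FOFormula.number_injective {ν : Type} [Encodable ν] :
    Function.Injective (FOFormula.number (ν := ν)) := by
  intro φ
  induction φ with
  | eq i j => intro ψ h; cases ψ <;> simp_all [FOFormula.number, Nat.pair_eq_pair]
  | mem i j => intro ψ h; cases ψ <;> simp_all [FOFormula.number, Nat.pair_eq_pair]
  | memName i k => intro ψ h; cases ψ <;> simp_all [FOFormula.number, Nat.pair_eq_pair]
  | neg φ ih =>
    intro ψ h
    cases ψ <;> simp only [FOFormula.number, Nat.pair_eq_pair] at h <;> try omega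
    rw [ih h.2]
  | and φ₁ φ₂ ih₁ ih₂ =>
    intro ψ h
    cases ψ <;> simp only [FOFormula.number, Nat.pair_eq_pair] at h <;> try omega
    rw [ih₁ h.2.1, ih₂ h.2.2]
  | all i φ ih =>
    intro ψ h
    cases ψ <;> simp only [FOFormula.number, Nat.pair_eq_pair] at h <;> try omega
    rw [h.2.1, ih h.2.2]

theorem SOFormula.number_injective : Function.Injective SOFormula.number := by
  intro φ
  induction φ with
  | eq i j => intro ψ h; cases ψ <;> simp_all [SOFormula.number, Nat.pair_eq_pair]
  | mem i j => intro ψ h; cases ψ <;> simp_all [SOFormula.number, Nat.pair_eq_pair]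
  | memVar i j => intro ψ h; cases ψ <;> simp_all [SOFormula.number, Nat.pair_eq_pair]
  | neg φ ih =>
    intro ψ h
    cases ψ <;> simp only [SOFormula.number, Nat.pair_eq_pair] at h <;> try omega
    rw [ih h.2]
  | and φ₁ φ₂ ih₁ ih₂ =>
    intro ψ h
    cases ψ <;> simp only [SOFormula.number, Nat.pair_eq_pair] at h <;> try omega
    rw [ih₁ h.2.1, ih₂ h.2.2]
  | all i φ ih =>
    intro ψ h
    cases ψ <;> simp only [SOFormula.number, Nat.pair_eq_pair] at h <;> try omega
    rw [h.2.1, ih h.2.2]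
  | allSet j φ ih =>
    intro ψ h
    cases ψ <;> simp only [SOFormula.number, Nat.pair_eq_pair] at h <;> try omega
    rw [h.2.1, ih h.2.2]

theorem interleave_injective : Function.Injective (interleave.{u}) := by
  intro s t h
  funext n i
  have := congrFun h (ω * i + n)
  simpa [interleave, mul_add_mod_self, mod_eq_of_lt (natCast_lt_omega0 n),
    mul_add_div _ omega0_ne_zero, div_eq_zero_of_lt (natCast_lt_omega0 n)] using this

theorem unary_injective : Function.Injective (unary.{u}) := by
  intro g h e
  have := congrFun e g
  simpa [unary] using this

theorem inputFO_injective {g g' : ℕ} {b b' : ℕ → Ordinal.{u} → Bool}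
    (h : inputFO g b = inputFO g' b') : g = g' ∧ b = b' := by
  have h := interleave_injective h
  exact ⟨unary_injective (congrFun h 0), funext fun n => congrFun h (n + 1)⟩

theorem inputSO_injective {g g' : ℕ} {b b' B B' : ℕ → Ordinal.{u} → Bool}
    (h : inputSO g b B = inputSO g' b' B') : g = g' ∧ b = b' ∧ B = B' := by
  have h := interleave_injective h
  refine ⟨unary_injective (by simpa using congrFun h 0), funext fun n => ?_, funext fun n => ?_⟩
  · have e := congrFun h (2 * n + 1)
    have h2 : (2 * n + 1) / 2 = n := by omega
    simpa [h2] using e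
  · have e := congrFun h (2 * n + 2)
    have h2 : (2 * n + 2) / 2 - 1 = n := by omega
    simpa [h2] using e

/-! ### The length of the input -/

theorem card_length {μ : Cardinal.{u}} (hμ : ℵ₀ ≤ μ) : (ω * (μ.ord * μ.ord)).card ≤ μ := by
  simp only [card_mul, card_omega0, card_ord, mul_eq_self hμ, aleph0_mul_eq hμ, le_refl]

theorem interleave_eq_false {l : Ordinal.{u}} {s : ℕ → Ordinal.{u} → Bool}
    (h : ∀ n i, l ≤ i → s n i = false) {ρ : Ordinal.{u}} (hρ : ω * l ≤ ρ) :
    interleave s ρ = false :=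
  h _ _ ((mul_le_iff_le_div omega0_ne_zero).1 hρ)

theorem omega0_le_ord_mul_ord {μ : Cardinal.{u}} (hμ : ℵ₀ ≤ μ) : ω ≤ μ.ord * μ.ord :=
  (omega0_le_ord.2 hμ).trans (le_mul_left _ (isSuccLimit_ord hμ).bot_lt)

theorem unary_eq_false {μ : Cardinal.{u}} (hμ : ℵ₀ ≤ μ) (g : ℕ) {i : Ordinal.{u}}
    (hi : μ.ord * μ.ord ≤ i) : unary g i = false := by
  have : i ≠ g := ((natCast_lt_omega0 g).trans_le ((omega0_le_ord_mul_ord hμ).trans hi)).ne'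
  simpa [unary] using this

theorem inputFO_eq_false {κ : Cardinal.{u}} (hκ : ℵ₀ ≤ κ) (g : ℕ) {b : ℕ → Ordinal.{u} → Bool}
    (hb : ∀ n i, κ.ord * κ.ord ≤ i → b n i = false) (ρ : Ordinal.{u})
    (hρ : ω * (κ.ord * κ.ord) ≤ ρ) : inputFO g b ρ = false := by
  refine interleave_eq_false (fun n i hi => ?_) hρ
  cases n with
  | zero => exact unary_eq_false hκ g hi
  | succ n => exact hb n i hi

theorem inputSO_eq_false {μ : Cardinal.{u}} (hμ : ℵ₀ ≤ μ) (g : ℕ) {b B : ℕ → Ordinal.{u} → Bool}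
    (hb : ∀ n i, μ.ord * μ.ord ≤ i → b n i = false)
    (hB : ∀ n i, μ.ord * μ.ord ≤ i → B n i = false) (ρ : Ordinal.{u})
    (hρ : ω * (μ.ord * μ.ord) ≤ ρ) : inputSO g b B ρ = false := by
  refine interleave_eq_false (fun n i hi => ?_) hρ
  split_ifs
  · exact unary_eq_false hμ g hi
  · exact hb _ i hi
  · exact hB _ i hi

/-! ### Truth as a function of the input -/

theorem exists_program_FO {ν : Type} [Encodable ν] {κ : Cardinal.{u}} (hκ : ℵ₀ ≤ κ)
    (D : Set ZFSet.{u}) (A : ν → ZFSet.{u}) :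
    ∃ p : Program.{u}, p.Supported (Size.uniform (2 ^ κ)) ∧
      ∀ (φ : FOFormula ν) (v : ℕ → ZFSet.{u}) (b : ℕ → Ordinal.{u} → Bool),
        (∀ n, Codes κ (b n) (v n)) →
          p.Answers (Size.uniform (2 ^ κ)) (inputFO φ.number b) (φ.Holds D A v) := by
  obtain ⟨p, hp, h⟩ := exists_program_answers hκ (card_length hκ) fun x =>
    ∃ (φ : FOFormula ν) (v : ℕ → ZFSet.{u}) (b : ℕ → Ordinal.{u} → Bool),
      (∀ n, Codes κ (b n) (v n)) ∧ x = inputFO φ.number b ∧ φ.Holds D A v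
  refine ⟨p, hp, fun φ v b hb => ?_⟩
  convert h _ (inputFO_eq_false hκ φ.number fun n => (hb n).1) using 1
  refine ⟨fun hφ => ⟨φ, v, b, hb, rfl, hφ⟩, ?_⟩
  rintro ⟨φ', v', b', hb', e, hφ⟩
  obtain ⟨e₁, rfl⟩ := inputFO_injective e
  rw [FOFormula.number_injective e₁, funext fun n => (hb n).unique hκ (hb' n)]
  exact hφ

theorem exists_program_SO {κ μ : Cardinal.{u}} (hκ : ℵ₀ ≤ κ) (hκμ : κ ≤ μ) (D : Set ZFSet.{u}) :
    ∃ p : Program.{u}, p.Supported (Size.uniform (2 ^ μ)) ∧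
      ∀ (φ : SOFormula) (v V : ℕ → ZFSet.{u}) (b B : ℕ → Ordinal.{u} → Bool),
        (∀ n, Codes κ (b n) (v n)) → (∀ n, Codes μ (B n) (V n)) →
          p.Answers (Size.uniform (2 ^ μ)) (inputSO φ.number b B) (φ.Holds D v V) := by
  have hμ := hκ.trans hκμ
  have hord : κ.ord * κ.ord ≤ μ.ord * μ.ord :=
    mul_le_mul' (ord_le_ord.2 hκμ) (ord_le_ord.2 hκμ)
  obtain ⟨p, hp, h⟩ := exists_program_answers hμ (card_length hμ) fun x =>
    ∃ (φ : SOFormula) (v V : ℕ → ZFSet.{u}) (b B : ℕ → Ordinal.{u} → Bool),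
      (∀ n, Codes κ (b n) (v n)) ∧ (∀ n, Codes μ (B n) (V n)) ∧
        x = inputSO φ.number b B ∧ φ.Holds D v V
  refine ⟨p, hp, fun φ v V b B hb hB => ?_⟩
  convert h _ (inputSO_eq_false hμ φ.number (fun n i hi => (hb n).1 i (hord.trans hi))
    fun n => (hB n).1) using 1
  refine ⟨fun hφ => ⟨φ, v, V, b, B, hb, hB, rfl, hφ⟩, ?_⟩
  rintro ⟨φ', v', V', b', B', hb', hB', e, hφ⟩
  obtain ⟨e₁, rfl, rfl⟩ := inputSO_injective e
  rw [SOFormula.number_injective e₁, funext fun n => (hb n).unique hκ (hb' n),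
    funext fun n => (hB n).unique hμ (hB' n)]
  exact hφ

end Hypercomputer

end

theorem theorem14 (κ : Cardinal.{u}) (hκ : Cardinal.aleph0 ≤ κ) :
    -- first-order propositions about sets that require at most `κ` bits
    (∃ p : Hypercomputer.Program.{u},
      p.Supported (Hypercomputer.Size.uniform (2 ^ κ)) ∧
      ∀ (φ : Hypercomputer.FOFormula Empty) (v : ℕ → ZFSet.{u}) (b : ℕ → Ordinal.{u} → Bool),
        (∀ n, Hypercomputer.Codes κ (b n) (v n)) →
        p.Answers (Hypercomputer.Size.uniform (2 ^ κ)) (Hypercomputer.inputFO φ.number b)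
          (φ.Holds {x | Hypercomputer.Bits κ x} (fun k => k.elim) v)) ∧
    -- the same with membership in specific sets `A k` that require at most `2 ^ κ` bits
    (∀ A : ℕ → ZFSet.{u}, (∀ k, Hypercomputer.Bits (2 ^ κ) (A k)) →
      ∃ p : Hypercomputer.Program.{u},
        p.Supported (Hypercomputer.Size.uniform (2 ^ κ)) ∧
        ∀ (φ : Hypercomputer.FOFormula ℕ) (v : ℕ → ZFSet.{u}) (b : ℕ → Ordinal.{u} → Bool),
          (∀ n, Hypercomputer.Codes κ (b n) (v n)) →
          p.Answers (Hypercomputer.Size.uniform (2 ^ κ)) (Hypercomputer.inputFO φ.number b)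
            (φ.Holds {x | Hypercomputer.Bits κ x} A v)) ∧
    -- second-order propositions about sets that require at most `κ` bits
    (∃ p : Hypercomputer.Program.{u},
      p.Supported (Hypercomputer.Size.uniform ((2 : Cardinal.{u}) ^ ((2 : Cardinal.{u}) ^ κ))) ∧
      ∀ (φ : Hypercomputer.SOFormula) (v V : ℕ → ZFSet.{u}) (b B : ℕ → Ordinal.{u} → Bool),
        (∀ n, Hypercomputer.Codes κ (b n) (v n)) →
        (∀ n, Hypercomputer.Codes (2 ^ κ) (B n) (V n)) →
        p.Answers (Hypercomputer.Size.uniform ((2 : Cardinal.{u}) ^ ((2 : Cardinal.{u}) ^ κ)))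
          (Hypercomputer.inputSO φ.number b B)
          (φ.Holds {x | Hypercomputer.Bits κ x} v V)) :=
  ⟨Hypercomputer.exists_program_FO hκ _ _,
    fun A _ => Hypercomputer.exists_program_FO hκ _ A,
    Hypercomputer.exists_program_SO hκ (Cardinal.cantor κ).le _⟩
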